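/- \textbf{Conventions.} IF formulas are built from atomic formulas (including equalities) over a vocabulary $L$ by $\neg,\wedge,\vee$ and the slashed quantifiers $(\forall v/V),(\exists v/V)$, $V$ a finite set of variables ($\forall v,\exists v$ abbreviate the case $V=\emptyset$), and $FV((Qv/V)\chi)=(FV(\chi)\setminus\{v\})\cup V$. They are interpreted by team semantics on structures with non-empty domain; in particular $M,X\models\psi\vee\chi$ iff $X=Y\cup Z$ with $M,Y\models\psi$ and $M,Z\models\chi$; $M,X\models(\forall v/V)\psi$ iff $M,X[M/v]\models\psi$; and $M,X\models(\exists v/V)\psi$ iff $M,X[F/v]\models\psi$ for some $F:X\to M$ whose value at $s$ depends only on the values of $s$ on variables outside $V$. A sentence is true in $M$ if $M,\{\emptyset\}\models\varphi$, and two sentences are (truth-)equivalent if they are true in the same structures. A positive initial tree is a finite tree of quantifiers and binary connectives in which every missing successor is marked by a gap $[\ ]$; a path leads from the root to a gap. It is regular if no variable is both free and bound in it and no variable is quantified again below a quantifier of the same variable. A completion of $T$ by a quantifier-free sentential completing function is the sentence obtained by filling each gap with a quantifier-free formula whose variables are all quantified along the path to that gap. A regular tree $T$ is in FO if, for every such completion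 $\varphi$, there is a first-order sentence (in the vocabulary $L$) with the same finite models as $\varphi$. A quantifier $(Q'w/W)$ depends on $(Qv/V)$ if it lies below it and $v\notin W$. A tree $U$ extends $T$ if there is an injection of the nodes of $T$ into the nodes of $U$ which preserves connectives, quantifiers and quantified variables (not necessarily slash sets), the order of the tree, and both dependence and non-dependence between quantifiers. For $\circ\in\{\wedge,\vee\}$, a tree is in GH1$(\circ)$, respectively GH2$(\circ)$, if it extends, for some pairwise distinct variables $x,y,u,v$, the tree $$\forall x\bigl((\exists u)[\ ]\circ\forall y(\exists v/\{x\})[\ ]\bigr),\qquad\text{respectively}\qquad \forall x\forall y\bigl((\exists u/\{y\})[\ ]\circ(\exists v/\{x\})[\ ]\bigr).$$ A tree is \emph{Henkin} if on one path there are quantifiers $\forall x,\exists y,\forall z,\exists w$ such that $\exists y$ depends on $\forall x$ but not on $\forall z,\exists w$, and $\exists w$ depends on $\forall z$ but not on $\forall x,\exists y$. It is \emph{signalling} if on one path there are $\forall x,\exists y,\exists z$ such that $\exists y$ depends on $\forall x$, and $\exists z$ depends on $\exists y$ but not on $\forall x$. It is \emph{coordinated} if it contains $\forall x,\vee,\forall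 y,\forall z,\exists u,\exists w$ such that $\vee$ lies below $\forall x$; $\exists u$ and $\exists w$ lie below $\vee$; $\exists u$ depends on $\forall y$ but not on $\forall x,\forall z,\exists w$; and $\exists w$ depends on $\forall z$ but not on $\forall x,\forall y,\exists u$. An \emph{extension$^*$} of GH2$(\wedge)$ is a tree in GH2$(\wedge)$ which is not Henkin, signalling or coordinated and is in none of GH1$(\wedge)$, GH1$(\vee)$, GH2$(\vee)$. \textbf{Theorem.} Let $x,y,z,u,v$ be pairwise distinct variables. The positive initial trees \begin{align*} \mathrm{C4}'&=\forall x\forall y\bigl([\ ]\vee((\exists u/\{x\})[\ ]\wedge\forall z(\exists v/\{x,y\})[\ ])\bigr),\\ \mathrm{C5}'&=\forall x\forall y\bigl([\ ]\vee\forall z((\exists u/\{x,z\})[\ ]\wedge(\exists v/\{x,y\})[\ ])\bigr),\\ \mathrm{C6}'&=\forall x\forall y\forall z\bigl([\ ]\vee((\exists u/\{x,z\})[\ ]\wedge(\exists v/\{x,y\})[\ ])\bigr) \end{align*} are regular and in FO. Moreover, there is a regular disjunction-free extension$^*$ $T$ of GH2$(\wedge)$, which is itself in FO, such that every sentence $\varphi$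 obtained from $\mathrm{C6}'$ by a quantifier-free sentential completing function is equivalent to a sentence obtained from $T$ by a quantifier-free sentential completing function; and every such $\varphi$ is equivalent, on all (finite or infinite) structures, to a first-order sentence. -/

import Mathlib

open FirstOrder

universe u v w

namespace IFLogic

/-- The two quantifiers. -/
inductive Quant
  | all
  | ex
  deriving DecidableEq

/-- The two binary connectives. -/
inductive Conn
  | and
  | or
  deriving DecidableEq

/-! ### Formulas of IF logic and team semantics -/

/-- IF formulas over a vocabulary `L`, with variables named by natural numbers.  The quantifier
`quant q v V φ` is `(q v / V) φ`, with finite slash set `V`. -/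
inductive Formula (L : FirstOrder.Language.{u, v}) : Type (max u v)
  | rel {n : ℕ} (R : L.Relations n) (ts : Fin n → L.Term ℕ) : Formula L
  | equal (t₁ t₂ : L.Term ℕ) : Formula L
  | neg (φ : Formula L) : Formula L
  | conn (c : Conn) (φ ψ : Formula L) : Formula L
  | quant (q : Quant) (x : ℕ) (V : Finset ℕ) (φ : Formula L) : Formula L

namespace Formula

variable {L : FirstOrder.Language.{u, v}}

/-- Free variables; the variables of a slash set occur free. -/
def freeVars : Formula L → Finset ℕ
  | rel _ ts => Finset.univ.biUnion fun i => (ts i).varFinset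
  | equal t₁ t₂ => t₁.varFinset ∪ t₂.varFinset
  | neg φ => φ.freeVars
  | conn _ φ ψ => φ.freeVars ∪ ψ.freeVars
  | quant _ x V φ => φ.freeVars.erase x ∪ V

/-- Formulas without quantifiers. -/
def QuantifierFree : Formula L → Prop
  | rel _ _ => True
  | equal _ _ => True
  | neg φ => φ.QuantifierFree
  | conn _ φ ψ => φ.QuantifierFree ∧ ψ.QuantifierFree
  | quant _ _ _ _ => False

end Formula

/-- Assignments of values in `M` to some of the variables: `s x = none` means that `x` is not in
the domain of `s`. -/
abbrev Assignment (M : Type w) := ℕ → Option M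

/-- Teams.  Those that arise in evaluating a sentence consist of assignments that share one
finite domain. -/
abbrev Team (M : Type w) := Set (Assignment M)

section Semantics

variable {M : Type w}

/-- The assignment `s(a/x)`. -/
def Assignment.set (s : Assignment M) (x : ℕ) (a : M) : Assignment M :=
  Function.update s x (some a)

/-- The duplicated team `X[M/x]`. -/
def Team.duplicate (X : Team M) (x : ℕ) : Team M :=
  {t | ∃ s ∈ X, ∃ a : M, t = s.set x a}

/-- The supplemented team `X[F/x]`. -/
def Team.supplement (X : Team M) (F : X → M) (x : ℕ) : Team M :=
  {t | ∃ s : X, t = s.1.set x (F s)}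

/-- `s ∼_V s'`, for assignments with the same domain. -/
def Assignment.EquivOutside (V : Finset ℕ) (s s' : Assignment M) : Prop :=
  ∀ x, x ∉ V → s x = s' x

/-- `V`-uniform functions on a team. -/
def Team.Uniform (X : Team M) (V : Finset ℕ) (F : X → M) : Prop :=
  ∀ s s' : X, s.1.EquivOutside V s'.1 → F s = F s'

/-- Value of a term under an assignment (arbitrary values are used for the variables outside the
domain; this never happens for suitable teams). -/
noncomputable def Assignment.eval {L : FirstOrder.Language.{u, v}} [L.Structure M] [Nonempty M]
    (s : Assignment M) (t : L.Term ℕ) : M :=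
  t.realize fun x => (s x).getD (Classical.arbitrary M)

/-- Team semantics: `Sat true φ X` is satisfaction `M, X ⊨ φ`, and `Sat false φ X` is negative
satisfaction `M, X ⊨⁻ φ`. -/
def Sat {L : FirstOrder.Language.{u, v}} (M : Type w) [L.Structure M] [Nonempty M] :
    Bool → Formula L → Team M → Prop
  | true, .rel R ts, X => ∀ s ∈ X, FirstOrder.Language.Structure.RelMap R fun i => s.eval (ts i)
  | false, .rel R ts, X => ∀ s ∈ X, ¬ FirstOrder.Language.Structure.RelMap R fun i => s.eval (ts i)
  | true, .equal t₁ t₂, X => ∀ s ∈ X, s.eval t₁ = s.eval t₂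
  | false, .equal t₁ t₂, X => ∀ s ∈ X, s.eval t₁ ≠ s.eval t₂
  | b, .neg φ, X => Sat M (!b) φ X
  | true, .conn .and φ ψ, X => Sat M true φ X ∧ Sat M true ψ X
  | true, .conn .or φ ψ, X => ∃ Y Z : Team M, Y ∪ Z = X ∧ Sat M true φ Y ∧ Sat M true ψ Z
  | false, .conn .and φ ψ, X => ∃ Y Z : Team M, Y ∪ Z = X ∧ Sat M false φ Y ∧ Sat M false ψ Z
  | false, .conn .or φ ψ, X => Sat M false φ X ∧ Sat M false ψ X
  | true, .quant .all x _ φ, X => Sat M true φ (X.duplicate x)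
  | true, .quant .ex x V φ, X => ∃ F : X → M, X.Uniform V F ∧ Sat M true φ (X.supplement F x)
  | false, .quant .all x V φ, X =>
      ∃ F : X → M, X.Uniform V F ∧ Sat M false φ (X.supplement F x)
  | false, .quant .ex x _ φ, X => Sat M false φ (X.duplicate x)

end Semantics

/-- Truth of an IF sentence in `M`: satisfaction by the team whose only member is the empty
assignment. -/
def Formula.TrueIn {L : FirstOrder.Language.{u, v}} (φ : Formula L) (M : Type w) [L.Structure M]
    [Nonempty M] : Prop :=
  Sat M true φ {fun _ => none}

/-- Truth equivalence of IF sentences. -/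
def TruthEquivalent {L : FirstOrder.Language.{u, v}} (φ ψ : Formula L) : Prop :=
  ∀ (M : Type w) [L.Structure M] [Nonempty M], φ.TrueIn M ↔ ψ.TrueIn M

/-- The IF sentence `φ` is true in the same structures as the first-order sentence `θ`. -/
def EquivalentToFO {L : FirstOrder.Language.{u, v}} (φ : Formula L) (θ : L.Sentence) : Prop :=
  ∀ (M : Type w) [L.Structure M] [Nonempty M], φ.TrueIn M ↔ M ⊨ θ

/-- The IF sentence `φ` has the same finite models as the first-order sentence `θ`. -/
def FinitelyEquivalentToFO {L : FirstOrder.Language.{u, v}} (φ : Formula L) (θ : L.Sentence) : Prop :=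
  ∀ (M : Type w) [L.Structure M] [Nonempty M] [Finite M], φ.TrueIn M ↔ M ⊨ θ

/-! ### Positive initial trees -/

/-- Positive initial trees: finite trees of quantifiers and binary connectives, where every
missing successor is filled by a gap. -/
inductive PITree
  | gap : PITree
  | conn (c : Conn) (T₁ T₂ : PITree) : PITree
  | quant (q : Quant) (x : ℕ) (V : Finset ℕ) (T : PITree) : PITree

/-- What stands at a position of a tree. -/
inductive Label
  | gap : Label
  | conn (c : Conn) : Label
  | quant (q : Quant) (x : ℕ) (V : Finset ℕ) : Label

namespace PITree

/-- The label at a position.  A position is the list of turns leading to it from the root: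
`false` for the left (or only) successor, `true` for the right one.  The value is `none` if the
tree has no such position. -/
def labelAt : PITree → List Bool → Option Label
  | gap, [] => some .gap
  | gap, _ :: _ => none
  | conn c _ _, [] => some (.conn c)
  | conn _ T₁ _, false :: p => T₁.labelAt p
  | conn _ _ T₂, true :: p => T₂.labelAt p
  | quant q x V _, [] => some (.quant q x V)
  | quant _ _ _ T, false :: p => T.labelAt p
  | quant _ _ _ _, true :: _ => none

/-- The paths of a tree, each given by the gap at its end. -/
abbrev Path (T : PITree) := {r : List Bool // T.labelAt r = some .gap}

/-- The nodes of a tree: occurrences of quantifiers and connectives. -/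
abbrev Node (T : PITree) := {p : List Bool // ∃ l, T.labelAt p = some l ∧ l ≠ .gap}

/-- Position `p'` is strictly below position `p`. -/
def Above (p p' : List Bool) : Prop := p <+: p' ∧ p ≠ p'

/-- Variables quantified along a path. -/
def boundOn (T : PITree) (r : T.Path) : Set ℕ :=
  {x | ∃ p q V, p <+: r.1 ∧ T.labelAt p = some (.quant q x V)}

/-- Variables quantified in a tree. -/
def boundVars : PITree → Finset ℕ
  | gap => ∅
  | conn _ T₁ T₂ => T₁.boundVars ∪ T₂.boundVars
  | quant _ x _ T => insert x T.boundVars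

/-- Variables occurring free in a tree. -/
def freeVars : PITree → Finset ℕ
  | gap => ∅
  | conn _ T₁ T₂ => T₁.freeVars ∪ T₂.freeVars
  | quant _ x V T => T.freeVars.erase x ∪ V

/-- No variable is both free and bound, and no variable is quantified again below a quantifier
of the same variable. -/
def Regular (T : PITree) : Prop :=
  Disjoint T.freeVars T.boundVars ∧
    ∀ p p' q q' x V V', T.labelAt p = some (.quant q x V) →
      T.labelAt p' = some (.quant q' x V') → ¬ Above p p'

/-- The formula obtained by filling every gap of `T` with the formula that `e` assigns to the
path ending there. -/
def complete {L : FirstOrder.Language.{u, v}} : (T : PITree) → (T.Path → Formula L) → Formula L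
  | gap, e => e ⟨[], rfl⟩
  | conn c T₁ T₂, e =>
      .conn c (T₁.complete fun r => e ⟨false :: r.1, r.2⟩)
        (T₂.complete fun r => e ⟨true :: r.1, r.2⟩)
  | quant q x V T, e => .quant q x V (T.complete fun r => e ⟨false :: r.1, r.2⟩)

/-- Weak completing functions: their values are quantifier-free formulas (which are always
regular). -/
def Weak {L : FirstOrder.Language.{u, v}} (T : PITree) (e : T.Path → Formula L) : Prop :=
  ∀ r, (e r).QuantifierFree

/-- Sentential completing functions: only variables bound along a path occur free in the formula
attached to it. -/
def Sentential {L : FirstOrder.Language.{u, v}} (T : PITree) (e : T.Path → Formula L) : Prop :=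
  ∀ r, ((e r).freeVars : Set ℕ) ⊆ T.boundOn r

/-- The regular tree `T` is in FO, with respect to the vocabulary `L`: for every weak, sentential
completing function, the class of finite models of the completed sentence is first-order
definable. -/
def InFO (L : FirstOrder.Language.{u, v}) (T : PITree) : Prop :=
  T.Regular ∧ ∀ e : T.Path → Formula L, T.Weak e → T.Sentential e →
    ∃ θ : L.Sentence, FinitelyEquivalentToFO.{u, v, w} (T.complete e) θ

/-- The quantifier at position `p'` depends on the quantifier at position `p`. -/
def DependsOn (T : PITree) (p' p : List Bool) : Prop :=
  ∃ q x V q' x' V', T.labelAt p = some (.quant q x V) ∧ T.labelAt p' = some (.quant q' x' V') ∧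
    Above p p' ∧ x ∉ V'

/-- There is a quantifier `(q x / V)`, for some `x` and `V`, at position `p`. -/
def HasQuant (T : PITree) (q : Quant) (p : List Bool) : Prop :=
  ∃ x V, T.labelAt p = some (.quant q x V)

/-- `T` has a Henkin path. -/
def Henkin (T : PITree) : Prop :=
  ∃ (r : T.Path) (x y z w : List Bool),
    (x <+: r.1 ∧ y <+: r.1 ∧ z <+: r.1 ∧ w <+: r.1) ∧
    (T.HasQuant .all x ∧ T.HasQuant .ex y ∧ T.HasQuant .all z ∧ T.HasQuant .ex w) ∧
    (T.DependsOn y x ∧ ¬ T.DependsOn y z ∧ ¬ T.DependsOn y w) ∧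
    (T.DependsOn w z ∧ ¬ T.DependsOn w x ∧ ¬ T.DependsOn w y)

/-- `T` has a signalling path. -/
def Signalling (T : PITree) : Prop :=
  ∃ (r : T.Path) (x y z : List Bool),
    (x <+: r.1 ∧ y <+: r.1 ∧ z <+: r.1) ∧
    (T.HasQuant .all x ∧ T.HasQuant .ex y ∧ T.HasQuant .ex z) ∧
    T.DependsOn y x ∧ T.DependsOn z y ∧ ¬ T.DependsOn z x

/-- `T` is coordinated (of the first or of the second kind). -/
def Coordinated (T : PITree) : Prop :=
  ∃ x d y z u w : List Bool,
    (T.HasQuant .all x ∧ T.labelAt d = some (.conn .or) ∧ T.HasQuant .all y ∧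
      T.HasQuant .all z ∧ T.HasQuant .ex u ∧ T.HasQuant .ex w) ∧
    (T.DependsOn u y ∧ ¬ T.DependsOn u x ∧ ¬ T.DependsOn u z ∧ ¬ T.DependsOn u w) ∧
    (T.DependsOn w z ∧ ¬ T.DependsOn w x ∧ ¬ T.DependsOn w y ∧ ¬ T.DependsOn w u) ∧
    Above x d ∧ Above d u ∧ Above d w

/-- No disjunction occurs in `T`. -/
def DisjunctionFree (T : PITree) : Prop := ∀ p, T.labelAt p ≠ some (.conn .or)

/-- `U` extends `T`: the nodes of `T` are mapped injectively to nodes of `U`, preserving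
connectives, quantifiers and quantified variables (but not necessarily slash sets), the order,
and both dependence and independence of quantifiers. -/
def Extends (U T : PITree) : Prop :=
  ∃ μ : T.Node → U.Node, Function.Injective μ ∧
    (∀ p q x V, T.labelAt p.1 = some (.quant q x V) →
      ∃ V', U.labelAt (μ p).1 = some (.quant q x V')) ∧
    (∀ p c, T.labelAt p.1 = some (.conn c) → U.labelAt (μ p).1 = some (.conn c)) ∧
    (∀ p p', Above p.1 p'.1 → Above (μ p).1 (μ p').1) ∧
    (∀ p p', (∃ q, T.HasQuant q p.1) → (∃ q, T.HasQuant q p'.1) →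
      (T.DependsOn p'.1 p.1 ↔ U.DependsOn (μ p').1 (μ p).1))

end PITree

/-- The minimal tree `∀x((∃u)[ ] ∘ ∀y(∃v/{x})[ ])`. -/
def minimalGH1 (c : Conn) (x y u v : ℕ) : PITree :=
  .quant .all x ∅ (.conn c (.quant .ex u ∅ .gap) (.quant .all y ∅ (.quant .ex v {x} .gap)))

/-- The minimal tree `∀x∀y((∃u/{y})[ ] ∘ (∃v/{x})[ ])`. -/
def minimalGH2 (c : Conn) (x y u v : ℕ) : PITree :=
  .quant .all x ∅ (.quant .all y ∅ (.conn c (.quant .ex u {y} .gap) (.quant .ex v {x} .gap)))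

/-- The class GH1(`c`): trees that extend the minimal tree, for some choice of the variables. -/
def PITree.IsGH1 (c : Conn) (T : PITree) : Prop :=
  ∃ x y u v : ℕ, [x, y, u, v].Nodup ∧ T.Extends (minimalGH1 c x y u v)

/-- The class GH2(`c`): trees that extend the minimal tree, for some choice of the variables. -/
def PITree.IsGH2 (c : Conn) (T : PITree) : Prop :=
  ∃ x y u v : ℕ, [x, y, u, v].Nodup ∧ T.Extends (minimalGH2 c x y u v)

/-- Starred extensions of GH2(∧): extensions of it that lie in none of the other isolated
classes. -/
def PITree.IsStarExtensionGH2And (T : PITree) : Prop :=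
  T.IsGH2 .and ∧ ¬ T.Henkin ∧ ¬ T.Signalling ∧ ¬ T.IsGH1 .and ∧ ¬ T.IsGH1 .or ∧
    ¬ T.IsGH2 .or ∧ ¬ T.Coordinated

/-- `∀x∀y([ ] ∨ ((∃u/{x})[ ] ∧ ∀z(∃v/{x,y})[ ]))` -/
def treeC4 (x y z u v : ℕ) : PITree :=
  .quant .all x ∅ (.quant .all y ∅ (.conn .or .gap
    (.conn .and (.quant .ex u {x} .gap) (.quant .all z ∅ (.quant .ex v {x, y} .gap)))))

/-- `∀x∀y([ ] ∨ ∀z((∃u/{x,z})[ ] ∧ (∃v/{x,y})[ ]))` -/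
def treeC5 (x y z u v : ℕ) : PITree :=
  .quant .all x ∅ (.quant .all y ∅ (.conn .or .gap
    (.quant .all z ∅ (.conn .and (.quant .ex u {x, z} .gap) (.quant .ex v {x, y} .gap)))))

/-- `∀x∀y∀z([ ] ∨ ((∃u/{x,z})[ ] ∧ (∃v/{x,y})[ ]))` -/
def treeC6 (x y z u v : ℕ) : PITree :=
  .quant .all x ∅ (.quant .all y ∅ (.quant .all z ∅ (.conn .or .gap
    (.conn .and (.quant .ex u {x, z} .gap) (.quant .ex v {x, y} .gap)))))

end IFLogic

namespace IFLogic

/-! ### Team semantics: quantifier-free formulas and slashed existential quantifiers -/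

section Semantics

/-! All three trees share the shape `α ∨ (… ∃s/V β ∧ … ∃t/W γ)` below a block of unslashed universal
quantifiers. The part of the team sent to the right of the disjunction may be taken as small as
possible: since satisfaction is downward closed and `α` is flat, it is exactly the set of
assignments falsifying `α`. The disjunction therefore involves no real choice; it only restricts the
team by a quantifier-free condition.

This restriction passes through a conjunction, through `∀z` when `z` is not free in `α`
(`Team.duplicate_sep`), and through a slashed existential, where it becomes a disjunct: `∃s/V β` on
the restricted team amounts to `∃s/V (α ∨ β)` on the whole team (`sat_ex_sep_iff`). What remains is
a conjunction of two slashed existentials, each over the team of all assignments on a fixed domain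
`D`. The two Skolem functions are chosen independently, and each condition is the first-order prefix
`∀(D \ V) ∃s ∀(D ∩ V)` (`exists_sentence_iff_sat_fullTeam`). Finiteness plays no role.

In the third tree all universal quantifiers precede the disjunction, so the same rewriting stays at
the level of trees and leads to `treeAnd`, whose gaps receive `α ∨ β` and `α ∨ γ`. Its existentials
lie on different paths and it has no disjunction, which excludes the other classes. -/

theorem Team.duplicate_mono {M : Type w} {X Y : Team M} (h : Y ⊆ X) (x : ℕ) :
    Y.duplicate x ⊆ X.duplicate x := by
  rintro _ ⟨s, hs, a, rfl⟩
  exact ⟨s, h hs, a, rfl⟩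

variable {L : FirstOrder.Language.{u, v}}

/-- The first-order formula corresponding to a quantifier-free formula. -/
def Formula.toFirstOrder : Formula L → L.Formula ℕ
  | .rel R ts => R.formula ts
  | .equal t₁ t₂ => t₁.equal t₂
  | .neg φ => φ.toFirstOrder.not
  | .conn .and φ ψ => φ.toFirstOrder ⊓ ψ.toFirstOrder
  | .conn .or φ ψ => φ.toFirstOrder ⊔ ψ.toFirstOrder
  | .quant _ _ _ _ => ⊥

variable {M : Type w} [L.Structure M]

theorem realize_toFirstOrder_congr (φ : Formula L) {a b : ℕ → M}
    (h : ∀ n ∈ φ.freeVars, a n = b n) : φ.toFirstOrder.Realize a ↔ φ.toFirstOrder.Realize b := by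
  have term : ∀ t : L.Term ℕ, (∀ n ∈ t.varFinset, a n = b n) → t.realize a = t.realize b := by
    intro t
    induction t with
    | var n => intro h; simpa using h
    | func f ts ih =>
      intro h
      simp only [FirstOrder.Language.Term.realize]
      congr 1
      funext i
      exact ih i fun n hn => h n (by simpa using ⟨i, hn⟩)
  induction φ with
  | rel R ts =>
    simp only [Formula.toFirstOrder, FirstOrder.Language.Formula.realize_rel]
    have : (fun i => (ts i).realize a) = fun i => (ts i).realize b :=
      funext fun i => term _ fun n hn => h n (by simpa [Formula.freeVars] using ⟨i, hn⟩)
    rw [this]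
  | equal t₁ t₂ =>
    simp only [Formula.freeVars, Finset.mem_union] at h
    simp only [Formula.toFirstOrder, FirstOrder.Language.Formula.realize_equal]
    rw [term t₁ fun n hn => h n (.inl hn), term t₂ fun n hn => h n (.inr hn)]
  | neg φ ih =>
    simp only [Formula.toFirstOrder, FirstOrder.Language.Formula.realize_not]
    exact not_congr (ih h)
  | conn c φ ψ ih₁ ih₂ =>
    simp only [Formula.freeVars, Finset.mem_union] at h
    have h₁ := ih₁ fun n hn => h n (.inl hn)
    have h₂ := ih₂ fun n hn => h n (.inr hn)
    cases c <;> simp only [Formula.toFirstOrder, FirstOrder.Language.Formula.realize_inf,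
      FirstOrder.Language.Formula.realize_sup]
    exacts [and_congr h₁ h₂, or_congr h₁ h₂]
  | quant => rfl

variable [Nonempty M]

/-- The total valuation extending an assignment by arbitrary values. -/
noncomputable def Assignment.valuation (s : Assignment M) : ℕ → M :=
  fun x => (s x).getD (Classical.arbitrary M)

/-- Classical satisfaction of a quantifier-free formula by an assignment. -/
def Assignment.Satisfies (s : Assignment M) (φ : Formula L) : Prop :=
  φ.toFirstOrder.Realize s.valuation

theorem Assignment.satisfies_set_iff {φ : Formula L} {x : ℕ} (hx : x ∉ φ.freeVars)
    (s : Assignment M) (a : M) : (s.set x a).Satisfies φ ↔ s.Satisfies φ := by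
  refine realize_toFirstOrder_congr φ fun n hn => ?_
  have : n ≠ x := fun h => hx (h ▸ hn)
  simp [Assignment.valuation, Assignment.set, this]

/-- Quantifier-free formulas are flat. -/
theorem sat_iff_of_quantifierFree {φ : Formula L} (hφ : φ.QuantifierFree) (X : Team M) :
    (Sat M true φ X ↔ ∀ s ∈ X, s.Satisfies φ) ∧ (Sat M false φ X ↔ ∀ s ∈ X, ¬ s.Satisfies φ) := by
  induction φ generalizing X with
  | rel R ts =>
    simp only [Sat, Assignment.Satisfies, Formula.toFirstOrder,
      FirstOrder.Language.Formula.realize_rel]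
    exact ⟨Iff.rfl, Iff.rfl⟩
  | equal t₁ t₂ =>
    simp only [Sat, Assignment.Satisfies, Formula.toFirstOrder,
      FirstOrder.Language.Formula.realize_equal]
    exact ⟨Iff.rfl, Iff.rfl⟩
  | neg φ ih =>
    obtain ⟨h₁, h₂⟩ := ih hφ X
    simp [Sat, h₁, h₂, Assignment.Satisfies, Formula.toFirstOrder]
  | conn c φ ψ ih₁ ih₂ =>
    have split : ∀ P Q : Assignment M → Prop,
        (∃ Y Z : Team M, Y ∪ Z = X ∧ (∀ s ∈ Y, P s) ∧ ∀ s ∈ Z, Q s) ↔ ∀ s ∈ X, P s ∨ Q s := by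
      intro P Q
      constructor
      · rintro ⟨Y, Z, rfl, hY, hZ⟩ s (hs | hs)
        exacts [.inl (hY s hs), .inr (hZ s hs)]
      · intro h
        refine ⟨{s ∈ X | P s}, {s ∈ X | Q s}, ?_, fun s hs => hs.2, fun s hs => hs.2⟩
        ext s
        simp only [Set.mem_union, Set.mem_ofPred_eq]
        have := h s
        tauto
    cases c
    · simp only [Sat, fun X => (ih₁ hφ.1 X).1, fun X => (ih₁ hφ.1 X).2, fun X => (ih₂ hφ.2 X).1,
        fun X => (ih₂ hφ.2 X).2, split, Assignment.Satisfies, Formula.toFirstOrder,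
        FirstOrder.Language.Formula.realize_inf]
      exact ⟨by grind, by grind⟩
    · simp only [Sat, fun X => (ih₁ hφ.1 X).1, fun X => (ih₁ hφ.1 X).2, fun X => (ih₂ hφ.2 X).1,
        fun X => (ih₂ hφ.2 X).2, split, Assignment.Satisfies, Formula.toFirstOrder,
        FirstOrder.Language.Formula.realize_sup]
      exact ⟨by grind, by grind⟩
  | quant => exact hφ.elim

/-- Satisfaction is downward closed. -/
theorem Sat.mono {φ : Formula L} {b : Bool} {X Y : Team M} (h : Sat M b φ X) (hYX : Y ⊆ X) :
    Sat M b φ Y := by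
  have split : ∀ {X Y : Team M} {P Q : Team M → Prop},
      (∀ {X Y : Team M}, P X → Y ⊆ X → P Y) → (∀ {X Y : Team M}, Q X → Y ⊆ X → Q Y) →
      Y ⊆ X → (∃ V Z : Team M, V ∪ Z = X ∧ P V ∧ Q Z) → ∃ V Z : Team M, V ∪ Z = Y ∧ P V ∧ Q Z := by
    rintro X Y P Q hP hQ hYX ⟨V, Z, rfl, hV, hZ⟩
    refine ⟨V ∩ Y, Z ∩ Y, ?_, hP hV Set.inter_subset_left, hQ hZ Set.inter_subset_left⟩
    rw [← Set.union_inter_distrib_right, Set.inter_eq_right.2 hYX]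
  have choice : ∀ {X Y : Team M} {P : Team M → Prop} {x : ℕ} {V : Finset ℕ},
      (∀ {X Y : Team M}, P X → Y ⊆ X → P Y) → Y ⊆ X →
      (∃ F : X → M, X.Uniform V F ∧ P (X.supplement F x)) →
      ∃ F : Y → M, Y.Uniform V F ∧ P (Y.supplement F x) := by
    rintro X Y P x V hP hYX ⟨F, hF, h⟩
    refine ⟨fun s => F ⟨s.1, hYX s.2⟩, fun s s' hs => hF _ _ hs, hP h ?_⟩
    rintro _ ⟨s, rfl⟩
    exact ⟨⟨s.1, hYX s.2⟩, rfl⟩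
  induction φ generalizing b X Y with
  | rel R ts => cases b <;> simp only [Sat] at h ⊢ <;> exact fun s hs => h s (hYX hs)
  | equal t₁ t₂ => cases b <;> simp only [Sat] at h ⊢ <;> exact fun s hs => h s (hYX hs)
  | neg φ ih => simp only [Sat] at h ⊢; exact ih h hYX
  | conn c φ ψ ih₁ ih₂ =>
    cases b <;> cases c <;> simp only [Sat] at h ⊢
    · exact split ih₁ ih₂ hYX h
    · exact ⟨ih₁ h.1 hYX, ih₂ h.2 hYX⟩
    · exact ⟨ih₁ h.1 hYX, ih₂ h.2 hYX⟩
    · exact split ih₁ ih₂ hYX h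
  | quant q x V φ ih =>
    cases b <;> cases q <;> simp only [Sat] at h ⊢
    · exact choice ih hYX h
    · exact ih h (Team.duplicate_mono hYX x)
    · exact ih h (Team.duplicate_mono hYX x)
    · exact choice ih hYX h

/-- By flatness, every assignment falsifying `α` must go to the part satisfying `ψ`; by downward
closure, nothing else needs to. -/
theorem sat_or_iff {α ψ : Formula L} (hα : α.QuantifierFree) (X : Team M) :
    Sat M true (.conn .or α ψ) X ↔ Sat M true ψ {s ∈ X | ¬ s.Satisfies α} := by
  simp only [Sat]
  constructor
  · rintro ⟨Y, Z, rfl, hY, hZ⟩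
    refine hZ.mono ?_
    rintro s ⟨hs | hs, hsα⟩
    exacts [(hsα (((sat_iff_of_quantifierFree hα Y).1.1 hY) s hs)).elim, hs]
  · intro h
    refine ⟨{s ∈ X | s.Satisfies α}, _, ?_, (sat_iff_of_quantifierFree hα _).1.2 fun s hs => hs.2, h⟩
    ext s
    simp only [Set.mem_union, Set.mem_ofPred_eq]
    tauto

/-- A `V`-uniform function is one value per class of the relation "equal outside `V`", so the choice
function can be replaced by a separate existence statement for each class. -/
theorem sat_ex_iff {φ : Formula L} (hφ : φ.QuantifierFree) (x : ℕ) (V : Finset ℕ) (X : Team M) :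
    Sat M true (.quant .ex x V φ) X ↔
      ∀ s ∈ X, ∃ a : M, ∀ s' ∈ X, s.EquivOutside V s' → (s'.set x a).Satisfies φ := by
  simp only [Sat, fun X : Team M => (sat_iff_of_quantifierFree hφ X).1]
  constructor
  · rintro ⟨F, hF, h⟩ s hs
    refine ⟨F ⟨s, hs⟩, fun s' hs' hss' => ?_⟩
    rw [hF ⟨s, hs⟩ ⟨s', hs'⟩ hss']
    exact h _ ⟨⟨s', hs'⟩, rfl⟩
  · intro h
    let r : Setoid X :=
      { r := fun s s' => s.1.EquivOutside V s'.1
        iseqv := ⟨fun s n _ => rfl, fun h n hn => (h n hn).symm,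
          fun h h' n hn => (h n hn).trans (h' n hn)⟩ }
    choose G hG using h
    -- Reading the value off the chosen representative of the class makes the function uniform.
    refine ⟨fun s => G _ (Quotient.mk r s).out.2, fun s s' hs => ?_, ?_⟩
    · have : Quotient.mk r s = Quotient.mk r s' := Quotient.sound hs
      simp only [this]
    · rintro _ ⟨s, rfl⟩
      exact hG _ _ _ s.2 (Quotient.exact (Quotient.out_eq (Quotient.mk r s)))

/-- A side condition on the team can be moved below a slashed existential quantifier. -/
theorem sat_ex_sep_iff {α φ : Formula L} (hα : α.QuantifierFree) (hφ : φ.QuantifierFree) {x : ℕ}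
    (hx : x ∉ α.freeVars) (V : Finset ℕ) (X : Team M) :
    Sat M true (.quant .ex x V φ) {s ∈ X | ¬ s.Satisfies α} ↔
      Sat M true (.quant .ex x V (.conn .or α φ)) X := by
  have or_iff : ∀ s : Assignment M,
      s.Satisfies (.conn .or α φ) ↔ s.Satisfies α ∨ s.Satisfies φ := fun s => by
    simp [Assignment.Satisfies, Formula.toFirstOrder]
  rw [sat_ex_iff hφ, sat_ex_iff (φ := .conn .or α φ) ⟨hα, hφ⟩]
  simp only [or_iff, Assignment.satisfies_set_iff hx, Set.mem_ofPred_eq]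
  constructor
  · intro h s hs
    -- A class that meets the restricted team takes the value chosen there; in a class lying inside
    -- `α` any value works, and this uses that the structure is non-empty.
    by_cases hc : ∃ s' ∈ X, s.EquivOutside V s' ∧ ¬ s'.Satisfies α
    · obtain ⟨s', hs', hss', hα'⟩ := hc
      obtain ⟨a, ha⟩ := h s' ⟨hs', hα'⟩
      refine ⟨a, fun t ht hst => or_iff_not_imp_left.2 fun hαt => ha t ⟨ht, hαt⟩ fun n hn => ?_⟩
      rw [← hss' n hn, hst n hn]
    · push Not at hc
      exact ⟨Classical.arbitrary M, fun s' hs' hss' => .inl (hc s' hs' hss')⟩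
  · intro h s hs
    obtain ⟨a, ha⟩ := h s hs.1
    exact ⟨a, fun s' hs' hss' => (ha s' hs'.1 hss').resolve_left hs'.2⟩

/-- This handles a universal quantifier standing below the disjunction: the restriction is moved
outside the duplication, which then yields a larger full team. -/
theorem Team.duplicate_sep {α : Formula L} {x : ℕ} (hx : x ∉ α.freeVars) (X : Team M) :
    Team.duplicate {s ∈ X | ¬ s.Satisfies α} x = {s ∈ X.duplicate x | ¬ s.Satisfies α} := by
  ext t
  constructor
  · rintro ⟨s, ⟨hs, hα⟩, a, rfl⟩
    exact ⟨⟨s, hs, a, rfl⟩, by rwa [Assignment.satisfies_set_iff hx]⟩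
  · rintro ⟨⟨s, hs, a, rfl⟩, hα⟩
    exact ⟨s, ⟨hs, by rwa [Assignment.satisfies_set_iff hx] at hα⟩, a, rfl⟩

end Semantics

end IFLogic
namespace IFLogic

/-! ### First-order definability of one slashed quantifier over a full team -/

section FullTeam

/-- The team of all assignments with domain `D`. -/
def fullTeam (M : Type w) (D : Finset ℕ) : Team M :=
  {s | ∀ n, (s n).isSome ↔ n ∈ D}

theorem fullTeam_empty (M : Type w) : fullTeam M ∅ = {fun _ => none} := by
  ext s
  simp [fullTeam, funext_iff]

theorem duplicate_fullTeam (M : Type w) (D : Finset ℕ) (x : ℕ) :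
    (fullTeam M D).duplicate x = fullTeam M (insert x D) := by
  ext t
  constructor
  · rintro ⟨s, hs, a, rfl⟩ n
    by_cases h : n = x <;> simp_all [fullTeam, Assignment.set]
  · intro ht
    obtain ⟨a, ha⟩ := Option.isSome_iff_exists.1 ((ht x).2 (Finset.mem_insert_self x D))
    -- If `x` already belongs to the domain, `t` is its own predecessor; otherwise the predecessor
    -- forgets the value at `x`.
    refine ⟨if x ∈ D then t else Function.update t x none, fun n => ?_, a, ?_⟩
    · have := ht n
      by_cases h : n = x
      · subst h; split_ifs <;> simp_all
      · split_ifs <;> simp_all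
    · funext n
      by_cases h : n = x
      · subst h; simp [Assignment.set, ha]
      · split_ifs <;> simp [Assignment.set, h]

variable {L : FirstOrder.Language.{u, v}}

/-- Over the team of all assignments with domain `D`, the quantifier `∃u/V` followed by a
quantifier-free formula is the first-order quantifier prefix `∀(D \ V) ∃u ∀(D ∩ V)`. -/
theorem exists_sentence_iff_sat_fullTeam {β : Formula L} (hβ : β.QuantifierFree) {D : Finset ℕ}
    (V : Finset ℕ) {x : ℕ} (hx : x ∉ D) (hfv : β.freeVars ⊆ insert x D) :
    ∃ θ : L.Sentence, ∀ (M : Type w) [L.Structure M] [Nonempty M],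
      Sat M true (.quant .ex x V β) (fullTeam M D) ↔ M ⊨ θ := by
  classical
  -- The index 0 is added only to give `g` a default target for variables outside `D` and different
  -- from `x`; these do not occur in `β`. The outer universal block ranges over all of `D₀`, but `g`
  -- sends variables of `D ∩ V` to the inner block, so their outer copies are vacuous.
  let D₀ : Finset ℕ := insert 0 D
  let g : ℕ → ((Empty ⊕ D₀) ⊕ Unit) ⊕ (D ∩ V : Finset ℕ) := fun n =>
    if h : n ∈ D ∩ V then .inr ⟨n, h⟩ else if n = x then .inl (.inr ()) else
      .inl (.inl (.inr (if h : n ∈ D then ⟨n, Finset.mem_insert_of_mem h⟩ else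
        ⟨0, Finset.mem_insert_self 0 D⟩)))
  refine ⟨FirstOrder.Language.Formula.iAlls D₀ (FirstOrder.Language.Formula.iExs Unit
    (FirstOrder.Language.Formula.iAlls (D ∩ V : Finset ℕ) (β.toFirstOrder.relabel g))), ?_⟩
  intro M _ _
  have dom : ∀ {s : Assignment M} {n : ℕ}, s ∈ fullTeam M D → n ∈ D →
      s n = some (s.valuation n) := by
    intro s n hs hn
    obtain ⟨a, ha⟩ := Option.isSome_iff_exists.1 ((hs n).2 hn)
    simp [Assignment.valuation, ha]
  simp only [sat_ex_iff hβ, FirstOrder.Language.Sentence.Realize,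
    FirstOrder.Language.Formula.realize_iAlls, FirstOrder.Language.Formula.realize_iExs,
    FirstOrder.Language.Formula.realize_relabel]
  constructor
  · intro h w
    let s : Assignment M := fun n =>
      if h : n ∈ D then some (w ⟨n, Finset.mem_insert_of_mem h⟩) else none
    obtain ⟨a, ha⟩ := h s fun n => by by_cases hn : n ∈ D <;> simp [s, hn]
    refine ⟨fun _ => a, fun w' => ?_⟩
    -- Overriding `s` on `D ∩ V` stays in the full team and in the class of `s`: fullness makes the
    -- inner universal block unrestricted.
    let s' : Assignment M := fun n => if h : n ∈ D ∩ V then some (w' ⟨n, h⟩) else s n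
    have hs' := ha s' (fun n => by
        by_cases hn : n ∈ D <;> by_cases hV : n ∈ V <;> simp [s', s, hn, hV])
      fun n hn => by simp [s', hn]
    refine (realize_toFirstOrder_congr β fun n hn => ?_).1 hs'
    by_cases hnx : n = x
    · subst hnx; simp [Assignment.valuation, Assignment.set, g, hx]
    · have hD : n ∈ D := (Finset.mem_insert.1 (hfv hn)).resolve_left hnx
      by_cases hV : n ∈ V <;>
        simp [Assignment.valuation, Assignment.set, g, hnx, hD, hV, s', s]
  · intro h s hs
    obtain ⟨a, ha⟩ := h fun n => s.valuation n
    refine ⟨a (), fun s' hs' hss' => ?_⟩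
    refine (realize_toFirstOrder_congr β fun n hn => ?_).1 (ha fun n => s'.valuation n)
    by_cases hnx : n = x
    · subst hnx; simp [Assignment.valuation, Assignment.set, g, hx]
    · have hD : n ∈ D := (Finset.mem_insert.1 (hfv hn)).resolve_left hnx
      by_cases hV : n ∈ V
      · simp [Assignment.valuation, Assignment.set, g, hnx, hD, hV]
      · simp [Assignment.valuation, Assignment.set, g, hnx, hD, hV, hss' n hV]

/-- If the truth of `φ` amounts to satisfaction of two slashed existential formulas by full teams,
then `φ` is first-order. -/
theorem exists_equivalentToFO {φ β γ : Formula L} (hβ : β.QuantifierFree) (hγ : γ.QuantifierFree)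
    {D E V W : Finset ℕ} {x y : ℕ} (hx : x ∉ D) (hy : y ∉ E)
    (hfβ : β.freeVars ⊆ insert x D) (hfγ : γ.freeVars ⊆ insert y E)
    (h : ∀ (M : Type w) [L.Structure M] [Nonempty M], φ.TrueIn M ↔
      Sat M true (.quant .ex x V β) (fullTeam M D) ∧
        Sat M true (.quant .ex y W γ) (fullTeam M E)) :
    ∃ θ : L.Sentence, EquivalentToFO.{u, v, w} φ θ := by
  obtain ⟨θ₁, h₁⟩ := exists_sentence_iff_sat_fullTeam.{u, v, w} hβ V hx hfβ
  obtain ⟨θ₂, h₂⟩ := exists_sentence_iff_sat_fullTeam.{u, v, w} hγ W hy hfγ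
  refine ⟨θ₁ ⊓ θ₂, fun M _ _ => ?_⟩
  rw [h, h₁, h₂]
  exact FirstOrder.Language.Formula.realize_inf.symm

theorem EquivalentToFO.finitelyEquivalentToFO {φ : Formula L} {θ : L.Sentence}
    (h : EquivalentToFO.{u, v, w} φ θ) : FinitelyEquivalentToFO.{u, v, w} φ θ :=
  fun M _ _ _ => h M

end FullTeam

/-! ### Regularity, and the variables bound on a path -/

namespace PITree

theorem mem_boundVars_of_labelAt : ∀ {T : PITree} {p : List Bool} {q : Quant} {x : ℕ}
    {V : Finset ℕ}, T.labelAt p = some (.quant q x V) → x ∈ T.boundVars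
  | gap, [], _, _, _, h => by simp [labelAt] at h
  | gap, _ :: _, _, _, _, h => by simp [labelAt] at h
  | conn _ _ _, [], _, _, _, h => by simp [labelAt] at h
  | conn _ T₁ _, false :: _, _, _, _, h =>
    Finset.mem_union_left _ (mem_boundVars_of_labelAt (T := T₁) h)
  | conn _ _ T₂, true :: _, _, _, _, h =>
    Finset.mem_union_right _ (mem_boundVars_of_labelAt (T := T₂) h)
  | quant _ _ _ _, [], _, _, _, h => by simp_all [labelAt, boundVars]
  | quant _ _ _ T, false :: _, _, _, _, h =>
    Finset.mem_insert_of_mem (mem_boundVars_of_labelAt (T := T) h)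
  | quant _ _ _ _, true :: _, _, _, _, h => by simp [labelAt] at h

/-- No variable is quantified again below a quantifier of the same variable. -/
def NoRequantification : PITree → Prop
  | gap => True
  | conn _ T₁ T₂ => T₁.NoRequantification ∧ T₂.NoRequantification
  | quant _ x _ T => x ∉ T.boundVars ∧ T.NoRequantification

/-- Regularity quantifies over all pairs of positions; this reduces its second clause to a recursive
condition that simplification can decide on a concrete tree. -/
theorem NoRequantification.not_above : ∀ {T : PITree}, T.NoRequantification →
    ∀ (p p' : List Bool) (q q' : Quant) (x : ℕ) (V V' : Finset ℕ),
      T.labelAt p = some (.quant q x V) → T.labelAt p' = some (.quant q' x V') → ¬ Above p p' := by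
  intro T
  induction T with
  | gap => intro _ p _ _ _ _ _ _ h; cases p <;> simp [labelAt] at h
  | conn c T₁ T₂ ih₁ ih₂ =>
    rintro ⟨h₁, h₂⟩ p p' q q' x V V' hp hp' ⟨⟨r, rfl⟩, hne⟩
    rcases p with _ | ⟨_ | _, p⟩
    · simp [labelAt] at hp
    · exact ih₁ h₁ p (p ++ r) q q' x V V' hp hp' ⟨⟨r, rfl⟩, by simpa using hne⟩
    · exact ih₂ h₂ p (p ++ r) q q' x V V' hp hp' ⟨⟨r, rfl⟩, by simpa using hne⟩
  | quant q₀ x₀ V₀ T ih =>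
    rintro ⟨h₁, h₂⟩ p p' q q' x V V' hp hp' ⟨⟨r, rfl⟩, hne⟩
    rcases p with _ | ⟨_ | _, p⟩
    · rcases r with _ | ⟨_ | _, r⟩
      · exact hne rfl
      · simp only [labelAt, Option.some.injEq, Label.quant.injEq] at hp
        exact h₁ (hp.2.1 ▸ mem_boundVars_of_labelAt hp')
      · simp [labelAt] at hp'
    · exact ih h₂ p (p ++ r) q q' x V V' hp hp' ⟨⟨r, rfl⟩, by simpa using hne⟩
    · simp [labelAt] at hp

/-- The variables quantified strictly above the end of a position. -/
def varsAbove : PITree → List Bool → Finset ℕ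
  | gap, _ => ∅
  | conn _ T₁ _, false :: p => T₁.varsAbove p
  | conn _ _ T₂, true :: p => T₂.varsAbove p
  | quant _ x _ T, false :: p => insert x (T.varsAbove p)
  | _, _ => ∅

/-- Turns the bound variables of a path into a finite set computed by recursion, so that
sententiality becomes a concrete inclusion at each gap. -/
theorem boundOn_eq_varsAbove (T : PITree) (r : T.Path) : T.boundOn r = T.varsAbove r.1 := by
  obtain ⟨r, hr⟩ := r
  ext n
  simp only [boundOn, Set.mem_ofPred_eq, Finset.mem_coe]
  induction T generalizing r with
  | gap =>
    cases r with
    | nil => simp [varsAbove, labelAt]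
    | cons => simp [labelAt] at hr
  | conn c T₁ T₂ ih₁ ih₂ =>
    rcases r with _ | ⟨_ | _, r⟩
    · simp [labelAt] at hr
    · rw [varsAbove, ← ih₁ r hr]
      constructor
      · rintro ⟨_ | ⟨_ | _, p⟩, q, V, hp, h⟩
        · simp [labelAt] at h
        · exact ⟨p, q, V, by simpa using hp, h⟩
        · simp at hp
      · rintro ⟨p, q, V, hp, h⟩
        exact ⟨false :: p, q, V, by simpa using hp, h⟩
    · rw [varsAbove, ← ih₂ r hr]
      constructor
      · rintro ⟨_ | ⟨_ | _, p⟩, q, V, hp, h⟩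
        · simp [labelAt] at h
        · simp at hp
        · exact ⟨p, q, V, by simpa using hp, h⟩
      · rintro ⟨p, q, V, hp, h⟩
        exact ⟨true :: p, q, V, by simpa using hp, h⟩
  | quant q₀ x₀ V₀ T ih =>
    rcases r with _ | ⟨_ | _, r⟩
    · simp [labelAt] at hr
    · rw [varsAbove, Finset.mem_insert, ← ih r hr]
      constructor
      · rintro ⟨_ | ⟨_ | _, p⟩, q, V, hp, h⟩
        · simp only [labelAt, Option.some.injEq, Label.quant.injEq] at h
          exact .inl h.2.1.symm
        · exact .inr ⟨p, q, V, by simpa using hp, h⟩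
        · simp at hp
      · rintro (rfl | ⟨p, q, V, hp, h⟩)
        · exact ⟨[], q₀, V₀, by simp, rfl⟩
        · exact ⟨false :: p, q, V, by simpa using hp, h⟩
    · simp [labelAt] at hr

theorem Sentential.freeVars_subset {L : FirstOrder.Language.{u, v}} {T : PITree}
    {e : T.Path → Formula L} (he : T.Sentential e) (r : T.Path) :
    (e r).freeVars ⊆ T.varsAbove r.1 := by
  have := he r
  rwa [boundOn_eq_varsAbove, Finset.coe_subset] at this

end PITree

end IFLogic
namespace IFLogic

/-! ### The three trees, and a disjunction-free form of the third -/

section Trees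

variable {L : FirstOrder.Language.{u, v}} {M : Type w} [L.Structure M] [Nonempty M]

theorem sat_or_and_iff {α β γ : Formula L} (hα : α.QuantifierFree) (hβ : β.QuantifierFree)
    (hγ : γ.QuantifierFree) {s t : ℕ} (hs : s ∉ α.freeVars) (ht : t ∉ α.freeVars)
    (V W : Finset ℕ) (X : Team M) :
    Sat M true (.conn .or α (.conn .and (.quant .ex s V β) (.quant .ex t W γ))) X ↔
      Sat M true (.quant .ex s V (.conn .or α β)) X ∧
        Sat M true (.quant .ex t W (.conn .or α γ)) X := by
  rw [sat_or_iff hα, ← sat_ex_sep_iff hα hβ hs, ← sat_ex_sep_iff hα hγ ht]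
  simp only [Sat]

/-- `∀x∀y∀z((∃s/{x,z})[ ] ∧ (∃t/{x,y})[ ])` -/
def treeAnd (x y z s t : ℕ) : PITree :=
  .quant .all x ∅ (.quant .all y ∅ (.quant .all z ∅
    (.conn .and (.quant .ex s {x, z} .gap) (.quant .ex t {x, y} .gap))))

theorem trueIn_all_all_iff (x y : ℕ) (V W : Finset ℕ) (φ : Formula L) :
    (Formula.quant .all x V (.quant .all y W φ)).TrueIn M ↔
      Sat M true φ (fullTeam M {y, x}) := by
  simp [Formula.TrueIn, Sat, ← fullTeam_empty, duplicate_fullTeam]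

variable {x y z s t : ℕ}

/-! ### The first two trees are in FO -/

theorem treeC4_inFO (h : [x, y, z, s, t].Nodup) :
    PITree.InFO.{u, v, w} L (treeC4 x y z s t) := by
  simp only [List.nodup_cons, List.mem_cons, List.not_mem_nil, not_or] at h
  refine ⟨⟨?_, PITree.NoRequantification.not_above ?_⟩, fun e hw hs => ?_⟩
  · simp [treeC4, PITree.freeVars, PITree.boundVars]; grind
  · simp [treeC4, PITree.NoRequantification, PITree.boundVars]; grind
  have hα := hw ⟨[false, false, false], rfl⟩
  have hβ := hw ⟨[false, false, true, false, false], rfl⟩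
  have hγ := hw ⟨[false, false, true, true, false, false], rfl⟩
  have fα := hs.freeVars_subset ⟨[false, false, false], rfl⟩
  have fβ := hs.freeVars_subset ⟨[false, false, true, false, false], rfl⟩
  have fγ := hs.freeVars_subset ⟨[false, false, true, true, false, false], rfl⟩
  have he : (treeC4 x y z s t).complete e = .quant .all x ∅ (.quant .all y ∅ (.conn .or
    (e ⟨[false, false, false], rfl⟩) (.conn .and
      (.quant .ex s {x} (e ⟨[false, false, true, false, false], rfl⟩))
      (.quant .all z ∅ (.quant .ex t {x, y}
        (e ⟨[false, false, true, true, false, false], rfl⟩)))))) := rfl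
  generalize e ⟨[false, false, false], rfl⟩ = α at *
  generalize e ⟨[false, false, true, false, false], rfl⟩ = β at *
  generalize e ⟨[false, false, true, true, false, false], rfl⟩ = γ at *
  simp only [treeC4, PITree.varsAbove, Finset.subset_iff, Finset.mem_insert,
    Finset.notMem_empty] at fα fβ fγ
  rw [he]
  have hzα : z ∉ α.freeVars := by grind
  have hsα : s ∉ α.freeVars := by grind
  have htα : t ∉ α.freeVars := by grind
  obtain ⟨θ, hθ⟩ := exists_equivalentToFO.{u, v, w} (β := .conn .or α β) (γ := .conn .or α γ)
    ⟨hα, hβ⟩ ⟨hα, hγ⟩ (D := {y, x}) (E := {z, y, x}) (V := {x}) (W := {x, y}) (x := s) (y := t)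
    (φ := .quant .all x ∅ (.quant .all y ∅ (.conn .or α (.conn .and (.quant .ex s {x} β)
      (.quant .all z ∅ (.quant .ex t {x, y} γ))))))
    (by grind) (by grind) (by grind [Formula.freeVars]) (by grind [Formula.freeVars]) fun M _ _ => by
      -- Both sides are brought to the team restricted by the failure of `α`; since `z` is not free
      -- in `α`, restricting and duplicating along `z` commute.
      rw [trueIn_all_all_iff, sat_or_iff hα, ← sat_ex_sep_iff hα hβ hsα,
        ← sat_ex_sep_iff hα hγ htα, ← duplicate_fullTeam M {y, x} z, ← Team.duplicate_sep hzα]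
      simp only [Sat]
  exact ⟨θ, hθ.finitelyEquivalentToFO⟩

theorem treeC5_inFO (h : [x, y, z, s, t].Nodup) :
    PITree.InFO.{u, v, w} L (treeC5 x y z s t) := by
  simp only [List.nodup_cons, List.mem_cons, List.not_mem_nil, not_or] at h
  refine ⟨⟨?_, PITree.NoRequantification.not_above ?_⟩, fun e hw hs => ?_⟩
  · simp [treeC5, PITree.freeVars, PITree.boundVars]; grind
  · simp [treeC5, PITree.NoRequantification, PITree.boundVars]; grind
  have hα := hw ⟨[false, false, false], rfl⟩
  have hβ := hw ⟨[false, false, true, false, false, false], rfl⟩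
  have hγ := hw ⟨[false, false, true, false, true, false], rfl⟩
  have fα := hs.freeVars_subset ⟨[false, false, false], rfl⟩
  have fβ := hs.freeVars_subset ⟨[false, false, true, false, false, false], rfl⟩
  have fγ := hs.freeVars_subset ⟨[false, false, true, false, true, false], rfl⟩
  have he : (treeC5 x y z s t).complete e = .quant .all x ∅ (.quant .all y ∅ (.conn .or
    (e ⟨[false, false, false], rfl⟩) (.quant .all z ∅ (.conn .and
      (.quant .ex s {x, z} (e ⟨[false, false, true, false, false, false], rfl⟩))
      (.quant .ex t {x, y} (e ⟨[false, false, true, false, true, false], rfl⟩)))))) := rfl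
  generalize e ⟨[false, false, false], rfl⟩ = α at *
  generalize e ⟨[false, false, true, false, false, false], rfl⟩ = β at *
  generalize e ⟨[false, false, true, false, true, false], rfl⟩ = γ at *
  simp only [treeC5, PITree.varsAbove, Finset.subset_iff, Finset.mem_insert,
    Finset.notMem_empty] at fα fβ fγ
  rw [he]
  have hzα : z ∉ α.freeVars := by grind
  have hsα : s ∉ α.freeVars := by grind
  have htα : t ∉ α.freeVars := by grind
  obtain ⟨θ, hθ⟩ := exists_equivalentToFO.{u, v, w} (β := .conn .or α β) (γ := .conn .or α γ)
    ⟨hα, hβ⟩ ⟨hα, hγ⟩ (D := {z, y, x}) (E := {z, y, x}) (V := {x, z}) (W := {x, y}) (x := s)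
    (y := t)
    (φ := .quant .all x ∅ (.quant .all y ∅ (.conn .or α (.quant .all z ∅ (.conn .and
      (.quant .ex s {x, z} β) (.quant .ex t {x, y} γ))))))
    (by grind) (by grind) (by grind [Formula.freeVars]) (by grind [Formula.freeVars]) fun M _ _ => by
      rw [trueIn_all_all_iff, sat_or_iff hα, ← sat_ex_sep_iff hα hβ hsα,
        ← sat_ex_sep_iff hα hγ htα, ← duplicate_fullTeam M {y, x} z, ← Team.duplicate_sep hzα]
      simp only [Sat]
  exact ⟨θ, hθ.finitelyEquivalentToFO⟩

theorem trueIn_all_all_all_and_iff (V W : Finset ℕ) (β γ : Formula L) :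
    (Formula.quant .all x ∅ (.quant .all y ∅ (.quant .all z ∅
      (.conn .and (.quant .ex s V β) (.quant .ex t W γ))))).TrueIn M ↔
      Sat M true (.quant .ex s V β) (fullTeam M {z, y, x}) ∧
        Sat M true (.quant .ex t W γ) (fullTeam M {z, y, x}) := by
  rw [trueIn_all_all_iff, ← duplicate_fullTeam M {y, x} z]
  simp only [Sat]

/-- The completion of `treeAnd` with given formulas at its two gaps. -/
def treeAndFill (x y z s t : ℕ) (β γ : Formula L) : (treeAnd x y z s t).Path → Formula L :=
  fun r => if r.1 = [false, false, false, false, false] then β else γ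

/-! ### Combinatorics of the disjunction-free tree -/

theorem treeAnd_path (r : List Bool) (hr : (treeAnd x y z s t).labelAt r = some .gap) :
    r = [false, false, false, false, false] ∨ r = [false, false, false, true, false] := by
  rcases r with _ | ⟨_ | _, _ | ⟨_ | _, _ | ⟨_ | _, _ | ⟨_ | _, _ | ⟨_ | _, _ | ⟨_, _⟩⟩⟩⟩⟩⟩ <;>
    simp_all [treeAnd, PITree.labelAt]

theorem treeAnd_node (p : List Bool) (l : Label) (h : (treeAnd x y z s t).labelAt p = some l)
    (hl : l ≠ .gap) :
    p = [] ∧ l = .quant .all x ∅ ∨ p = [false] ∧ l = .quant .all y ∅ ∨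
      p = [false, false] ∧ l = .quant .all z ∅ ∨ p = [false, false, false] ∧ l = .conn .and ∨
      p = [false, false, false, false] ∧ l = .quant .ex s {x, z} ∨
      p = [false, false, false, true] ∧ l = .quant .ex t {x, y} := by
  rcases p with _ | ⟨_ | _, _ | ⟨_ | _, _ | ⟨_ | _, _ | ⟨_ | _, _ | ⟨_ | _, _ | ⟨_, _⟩⟩⟩⟩⟩⟩ <;>
    simp_all [treeAnd, PITree.labelAt]

theorem minimalGH2_node (c : Conn) (p : List Bool) (l : Label)
    (h : (minimalGH2 c x y s t).labelAt p = some l) (hl : l ≠ .gap) :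
    p = [] ∧ l = .quant .all x ∅ ∨ p = [false] ∧ l = .quant .all y ∅ ∨
      p = [false, false] ∧ l = .conn c ∨
      p = [false, false, false] ∧ l = .quant .ex s {y} ∨
      p = [false, false, true] ∧ l = .quant .ex t {x} := by
  rcases p with _ | ⟨_ | _, _ | ⟨_ | _, _ | ⟨_ | _, _ | ⟨_ | _, _ | ⟨_, _⟩⟩⟩⟩⟩ <;>
    simp_all [minimalGH2, PITree.labelAt]

theorem treeAnd_regular (h : [x, y, z, s, t].Nodup) : (treeAnd x y z s t).Regular := by
  simp only [List.nodup_cons, List.mem_cons, List.not_mem_nil, not_or] at h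
  refine ⟨?_, PITree.NoRequantification.not_above ?_⟩
  · simp [treeAnd, PITree.freeVars, PITree.boundVars]; grind
  · simp [treeAnd, PITree.NoRequantification, PITree.boundVars]; grind

theorem treeAnd_disjunctionFree : (treeAnd x y z s t).DisjunctionFree := fun p hp => by
  simpa using treeAnd_node p _ hp (by simp)

/-- The existential quantifiers of `treeAnd` lie on different paths. -/
theorem treeAnd_ex_unique {r p p' : List Bool} (hp : (treeAnd x y z s t).HasQuant .ex p)
    (hp' : (treeAnd x y z s t).HasQuant .ex p') (hr : p <+: r) (hr' : p' <+: r) : p = p' := by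
  obtain ⟨n, V, hp⟩ := hp
  obtain ⟨n', V', hp'⟩ := hp'
  have h₁ := treeAnd_node p _ hp (by simp)
  have h₂ := treeAnd_node p' _ hp' (by simp)
  obtain ⟨k, rfl⟩ := hr
  obtain ⟨k', hk⟩ := hr'
  simp only [reduceCtorEq, and_false, false_and, false_or, Label.quant.injEq] at h₁ h₂
  rcases h₁ with ⟨rfl, _⟩ | ⟨rfl, _⟩ <;> rcases h₂ with ⟨rfl, _⟩ | ⟨rfl, _⟩ <;> simp_all

/-- The subtree below the outermost `∀x` is the minimal tree on `y, z, s, t`, except that `x` is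
added to both slash sets. The embedding prepends one turn, and dependence is preserved because the
slash sets agree on these four variables. -/
theorem treeAnd_isGH2 (h : [x, y, z, s, t].Nodup) : (treeAnd x y z s t).IsGH2 .and := by
  have hd : [y, z, s, t].Nodup := (List.nodup_cons.1 h).2
  refine ⟨y, z, s, t, hd, ?_⟩
  have lift : ∀ p l, (minimalGH2 .and y z s t).labelAt p = some l → l ≠ .gap →
      ∃ l', (treeAnd x y z s t).labelAt (false :: p) = some l' ∧ l' ≠ .gap ∧
        (∀ c, l = .conn c → l' = .conn c) ∧
        ∀ q n V, l = .quant q n V → ∃ V', l' = .quant q n V' ∧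
          ∀ m, m = y ∨ m = z ∨ m = s ∨ m = t → (m ∈ V ↔ m ∈ V') := by
    simp only [List.nodup_cons, List.mem_cons, List.not_mem_nil, not_or] at h
    intro p l hp hl
    rcases minimalGH2_node .and p l hp hl with ⟨rfl, rfl⟩ | ⟨rfl, rfl⟩ | ⟨rfl, rfl⟩ |
      ⟨rfl, rfl⟩ | ⟨rfl, rfl⟩ <;> simp [treeAnd, PITree.labelAt] <;> grind
  refine ⟨fun p => ⟨false :: p.1, ?_⟩, fun p p' hpp' => ?_, ?_, ?_, ?_, ?_⟩
  · obtain ⟨p, l, hp, hl⟩ := p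
    obtain ⟨l', h₁, h₂, -⟩ := lift p l hp hl
    exact ⟨l', h₁, h₂⟩
  · simpa [Subtype.ext_iff] using hpp'
  · intro p q n V hp
    obtain ⟨l', h₁, -, -, h₂⟩ := lift _ _ hp (by simp)
    obtain ⟨V', rfl, -⟩ := h₂ q n V rfl
    exact ⟨V', h₁⟩
  · intro p c hp
    obtain ⟨l', h₁, -, h₂, -⟩ := lift _ _ hp (by simp)
    rw [h₁, h₂ c rfl]
  · rintro p p' ⟨hpp', hne⟩
    exact ⟨by simpa using hpp', by simpa using hne⟩
  · rintro p p' ⟨q, n, V, hp⟩ ⟨q', n', V', hp'⟩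
    obtain ⟨l, h₁, -, -, h₂⟩ := lift _ _ hp (by simp)
    obtain ⟨W, rfl, -⟩ := h₂ q n V rfl
    obtain ⟨l', h₁', -, -, h₂'⟩ := lift _ _ hp' (by simp)
    obtain ⟨W', rfl, hW⟩ := h₂' q' n' V' rfl
    have hn : n = y ∨ n = z ∨ n = s ∨ n = t := by
      have := minimalGH2_node _ _ _ hp (by simp)
      simp only [Label.quant.injEq, reduceCtorEq] at this
      tauto
    have above : PITree.Above p.1 p'.1 ↔ PITree.Above (false :: p.1) (false :: p'.1) := by
      simp [PITree.Above]
    simp only [PITree.DependsOn, hp, hp', h₁, h₁', ← above, Option.some.injEq, Label.quant.injEq]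
    constructor
    · rintro ⟨_, _, _, _, _, _, ⟨rfl, rfl, rfl⟩, ⟨rfl, rfl, rfl⟩, ha, hm⟩
      exact ⟨_, _, _, _, _, _, ⟨rfl, rfl, rfl⟩, ⟨rfl, rfl, rfl⟩, ha, fun hm' => hm ((hW _ hn).2 hm')⟩
    · rintro ⟨_, _, _, _, _, _, ⟨rfl, rfl, rfl⟩, ⟨rfl, rfl, rfl⟩, ha, hm⟩
      exact ⟨_, _, _, _, _, _, ⟨rfl, rfl, rfl⟩, ⟨rfl, rfl, rfl⟩, ha, fun hm' => hm ((hW _ hn).1 hm')⟩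

/-- A Henkin or signalling path needs two existentials differing in their dependence on one
universal quantifier, hence two distinct ones on a path. GH1(∧) needs a universal quantifier below a
conjunction, and the remaining classes need a disjunction. -/
theorem treeAnd_isStarExtension (h : [x, y, z, s, t].Nodup) :
    (treeAnd x y z s t).IsStarExtensionGH2And := by
  refine ⟨treeAnd_isGH2 h, ?_, ?_, ?_, ?_, ?_, ?_⟩
  · rintro ⟨r, a, b, c, d, ⟨-, hb, -, hd⟩, ⟨-, qb, -, qd⟩, ⟨hab, -, -⟩, -, had, -⟩
    exact had (treeAnd_ex_unique qb qd hb hd ▸ hab)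
  · rintro ⟨r, a, b, c, ⟨-, hb, hc⟩, ⟨-, qb, qc⟩, hba, -, hca⟩
    exact hca (treeAnd_ex_unique qb qc hb hc ▸ hba)
  · rintro ⟨a, b, c, d, -, μ, -, hq, hc, ha, -⟩
    have h₁ := hc ⟨[false], _, rfl, by simp⟩ .and rfl
    obtain ⟨V, h₂⟩ := hq ⟨[false, true], _, rfl, by simp⟩ .all b ∅ rfl
    obtain ⟨⟨k, hk⟩, -⟩ := ha ⟨[false], _, rfl, by simp⟩ ⟨[false, true], _, rfl, by simp⟩
      ⟨by simp, by simp⟩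
    have h₃ := treeAnd_node _ _ h₁ (by simp)
    have h₄ := treeAnd_node _ _ h₂ (by simp)
    simp only [reduceCtorEq, and_false, false_or, or_false, and_true, Label.quant.injEq,
      false_and] at h₃ h₄
    -- The only conjunction sits below all three universal quantifiers, so none of their positions
    -- can extend its position.
    rw [h₃] at hk
    rcases h₄ with ⟨h₄, -⟩ | ⟨h₄, -⟩ | ⟨h₄, -⟩ <;> simp [h₄] at hk
  · rintro ⟨a, b, c, d, -, μ, -, -, hc, -⟩
    exact treeAnd_disjunctionFree _ (hc ⟨[false], _, rfl, by simp⟩ .or rfl)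
  · rintro ⟨a, b, c, d, -, μ, -, -, hc, -⟩
    exact treeAnd_disjunctionFree _ (hc ⟨[false, false], _, rfl, by simp⟩ .or rfl)
  · rintro ⟨-, d, -, -, -, -, ⟨-, hd, -⟩, -⟩
    exact treeAnd_disjunctionFree d hd

/-! ### First-order equivalents and the reduction of the third tree -/

theorem treeAnd_equivalentToFO (h : [x, y, z, s, t].Nodup)
    (e : (treeAnd x y z s t).Path → Formula L) (hw : (treeAnd x y z s t).Weak e)
    (hs : (treeAnd x y z s t).Sentential e) :
    ∃ θ : L.Sentence, EquivalentToFO.{u, v, w} ((treeAnd x y z s t).complete e) θ := by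
  simp only [List.nodup_cons, List.mem_cons, List.not_mem_nil, not_or] at h
  have fβ := hs.freeVars_subset ⟨[false, false, false, false, false], rfl⟩
  have fγ := hs.freeVars_subset ⟨[false, false, false, true, false], rfl⟩
  simp only [treeAnd, PITree.varsAbove, Finset.subset_iff, Finset.mem_insert,
    Finset.notMem_empty] at fβ fγ
  exact exists_equivalentToFO (hw ⟨[false, false, false, false, false], rfl⟩)
    (hw ⟨[false, false, false, true, false], rfl⟩)
    (D := {z, y, x}) (E := {z, y, x}) (x := s) (y := t) (by grind) (by grind)
    (fun n hn => by have := fβ hn; grind) (fun n hn => by have := fγ hn; grind) fun M _ _ => trueIn_all_all_all_and_iff _ _ _ _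

/-- Every completion of the third tree is equivalent to a completion of `treeAnd`. -/
theorem treeC6_truthEquivalent (h : [x, y, z, s, t].Nodup)
    (e : (treeC6 x y z s t).Path → Formula L) (hw : (treeC6 x y z s t).Weak e)
    (hs : (treeC6 x y z s t).Sentential e) :
    ∃ e' : (treeAnd x y z s t).Path → Formula L, (treeAnd x y z s t).Weak e' ∧
      (treeAnd x y z s t).Sentential e' ∧
      TruthEquivalent.{u, v, w} ((treeC6 x y z s t).complete e)
        ((treeAnd x y z s t).complete e') := by
  simp only [List.nodup_cons, List.mem_cons, List.not_mem_nil, not_or] at h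
  have hα := hw ⟨[false, false, false, false], rfl⟩
  have hβ := hw ⟨[false, false, false, true, false, false], rfl⟩
  have hγ := hw ⟨[false, false, false, true, true, false], rfl⟩
  have fα := hs.freeVars_subset ⟨[false, false, false, false], rfl⟩
  have fβ := hs.freeVars_subset ⟨[false, false, false, true, false, false], rfl⟩
  have fγ := hs.freeVars_subset ⟨[false, false, false, true, true, false], rfl⟩
  have he : (treeC6 x y z s t).complete e = .quant .all x ∅ (.quant .all y ∅ (.quant .all z ∅
    (.conn .or (e ⟨[false, false, false, false], rfl⟩) (.conn .and
      (.quant .ex s {x, z} (e ⟨[false, false, false, true, false, false], rfl⟩))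
      (.quant .ex t {x, y} (e ⟨[false, false, false, true, true, false], rfl⟩)))))) := rfl
  generalize e ⟨[false, false, false, false], rfl⟩ = α at *
  generalize e ⟨[false, false, false, true, false, false], rfl⟩ = β at *
  generalize e ⟨[false, false, false, true, true, false], rfl⟩ = γ at *
  simp only [treeC6, PITree.varsAbove, Finset.subset_iff, Finset.mem_insert,
    Finset.notMem_empty] at fα fβ fγ
  have hsα : s ∉ α.freeVars := by grind
  have htα : t ∉ α.freeVars := by grind
  -- Copying `α` into both gaps stays sentential, because its variables are among `x, y, z`, which
  -- are quantified on both paths.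
  refine ⟨treeAndFill x y z s t (.conn .or α β) (.conn .or α γ), fun r => ?_, fun r => ?_,
    fun M _ _ => ?_⟩
  · unfold treeAndFill
    split_ifs
    exacts [⟨hα, hβ⟩, ⟨hα, hγ⟩]
  · rw [PITree.boundOn_eq_varsAbove, Finset.coe_subset]
    rcases treeAnd_path r.1 r.2 with hr | hr <;>
      simp [treeAndFill, hr, treeAnd, PITree.varsAbove, Formula.freeVars] <;> grind
  · rw [he]
    refine Iff.trans ?_ (trueIn_all_all_all_and_iff (x := x) (y := y) (z := z) (s := s) (t := t)
      {x, z} {x, y} (.conn .or α β) (.conn .or α γ)).symm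
    rw [trueIn_all_all_iff, ← sat_or_and_iff hα hβ hγ hsα htα, ← duplicate_fullTeam M {y, x} z]
    simp only [Sat]

theorem treeC6_equivalentToFO (h : [x, y, z, s, t].Nodup)
    (e : (treeC6 x y z s t).Path → Formula L) (hw : (treeC6 x y z s t).Weak e)
    (hs : (treeC6 x y z s t).Sentential e) :
    ∃ θ : L.Sentence, EquivalentToFO.{u, v, w} ((treeC6 x y z s t).complete e) θ := by
  obtain ⟨e', hw', hs', he'⟩ := treeC6_truthEquivalent.{u, v, w} h e hw hs
  obtain ⟨θ, hθ⟩ := treeAnd_equivalentToFO.{u, v, w} h e' hw' hs'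
  exact ⟨θ, fun M _ _ => (he' M).trans (hθ M)⟩

theorem treeC6_regular (h : [x, y, z, s, t].Nodup) : (treeC6 x y z s t).Regular := by
  simp only [List.nodup_cons, List.mem_cons, List.not_mem_nil, not_or] at h
  refine ⟨?_, PITree.NoRequantification.not_above ?_⟩
  · simp [treeC6, PITree.freeVars, PITree.boundVars]; grind
  · simp [treeC6, PITree.NoRequantification, PITree.boundVars]; grind

end Trees

end IFLogic

theorem mainTheorem12 (L : FirstOrder.Language.{u, v}) (x y z s t : ℕ)
    (hdistinct : [x, y, z, s, t].Nodup) :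
    IFLogic.PITree.InFO.{u, v, w} L (IFLogic.treeC4 x y z s t) ∧
    IFLogic.PITree.InFO.{u, v, w} L (IFLogic.treeC5 x y z s t) ∧
    IFLogic.PITree.InFO.{u, v, w} L (IFLogic.treeC6 x y z s t) ∧
    (∃ T : IFLogic.PITree,
      T.Regular ∧ T.DisjunctionFree ∧ T.IsStarExtensionGH2And ∧
      IFLogic.PITree.InFO.{u, v, w} L T ∧
      ∀ e : (IFLogic.treeC6 x y z s t).Path → IFLogic.Formula L,
        (IFLogic.treeC6 x y z s t).Weak e → (IFLogic.treeC6 x y z s t).Sentential e →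
        (∃ e' : T.Path → IFLogic.Formula L, T.Weak e' ∧ T.Sentential e' ∧
          IFLogic.TruthEquivalent.{u, v, w}
            ((IFLogic.treeC6 x y z s t).complete e) (T.complete e')) ∧
        ∃ θ : L.Sentence,
          IFLogic.EquivalentToFO.{u, v, w} ((IFLogic.treeC6 x y z s t).complete e) θ) := by
  refine ⟨IFLogic.treeC4_inFO hdistinct, IFLogic.treeC5_inFO hdistinct,
    ⟨IFLogic.treeC6_regular hdistinct, fun e hw hs => ?_⟩, IFLogic.treeAnd x y z s t,
    IFLogic.treeAnd_regular hdistinct, IFLogic.treeAnd_disjunctionFree,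
    IFLogic.treeAnd_isStarExtension hdistinct,
    ⟨IFLogic.treeAnd_regular hdistinct, fun e hw hs => ?_⟩, fun e hw hs =>
    ⟨IFLogic.treeC6_truthEquivalent hdistinct e hw hs,
      IFLogic.treeC6_equivalentToFO hdistinct e hw hs⟩⟩
  · obtain ⟨θ, hθ⟩ := IFLogic.treeC6_equivalentToFO.{u, v, w} hdistinct e hw hs
    exact ⟨θ, hθ.finitelyEquivalentToFO⟩
  · obtain ⟨θ, hθ⟩ := IFLogic.treeAnd_equivalentToFO.{u, v, w} hdistinct e hw hs
    exact ⟨θ, hθ.finitelyEquivalentToFO⟩
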